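/- Let $\mathcal{M}$ be a model category and let $\mathcal{C}$ be a class of cofibrations between cofibrant objects of $\mathcal{M}$. A fibrant object $Z$ is $\mathcal{C}$-local if every $f\colon A\to B$ in $\mathcal{C}$ induces a weak equivalence of homotopy function complexes $\mathrm{map}(B,Z)\to\mathrm{map}(A,Z)$; a map $f\colon A\to B$ of $\mathcal{M}$ is a $\mathcal{C}$-local equivalence if it induces such a weak equivalence for every $\mathcal{C}$-local $Z$. Suppose that the left Bousfield localization $L_{\mathcal{C}}\mathcal{M}$ exists, that is, that there is a model structure on the category $\mathcal{M}$ with the same cofibrations, with the $\mathcal{C}$-local equivalences as weak equivalences, and whose fibrant objects are exactly the $\mathcal{C}$-local objects. Let $K$ be a comonad on $\mathcal{M}$ with forgetful functor $U\colon \mathsf{Coalg}(K)\to\mathcal{M}$, and suppose that $\mathsf{Coalg}(K)$ admits the left-induced model structure along $U$ over $\mathcal{M}$, denoted $\mathsf{Coalg}(K;\mathcal{M})$, and also the left-induced model structure along $U$ over $L_{\mathcal{C}}\mathcal{M}$, denoted $\mathsf{Coalg}(K;L_{\mathcal{C}}\mathcal{M})$ (left-induced: a map $f$ is a weak equivalence,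 resp. a cofibration, if and only if $Uf$ is). Factorizations into a trivial cofibration followed by a fibration in $\mathsf{Coalg}(K;L_{\mathcal{C}}\mathcal{M})$ are assumed functorial, as is part of the definition of a model category used here. For an object $Y$ of $\mathcal{M}$, a localization $L_{\mathcal{C}}Y$ is any $\mathcal{C}$-local object equipped with a $\mathcal{C}$-local equivalence $j\colon Q\to L_{\mathcal{C}}Y$, where $q\colon Q\to Y$ is a weak equivalence of $\mathcal{M}$ with $Q$ cofibrant; the localization map is $l = j\circ q^{-1}\colon Y\to L_{\mathcal{C}}Y$ in $\mathsf{Ho}(\mathcal{M})$. If $U\colon\mathsf{Coalg}(K;L_{\mathcal{C}}\mathcal{M})\to L_{\mathcal{C}}\mathcal{M}$ preserves fibrant objects, then $L_{\mathcal{C}}$ preserves $K$-coalgebras, that is: 1. For each $K$-coalgebra $X$ there is a $K$-coalgebra $\widetilde{X}$ such that $U\widetilde{X}$ is $\mathcal{C}$-local and is weakly equivalent in $\mathcal{M}$ (through a zigzag of weak equivalences) to every localization $L_{\mathcal{C}}UX$. 2. For $X$ cofibrant in $\mathsf{Coalg}(K;\mathcal{M})$ there is a choice of $\widetilde{X}$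 as in (1), functorial in the cofibrant coalgebra $X$, together with a $K$-coalgebra map $r\colon X\to\widetilde{X}$ natural in $X$, such that for every localization $l\colon UX\to L_{\mathcal{C}}UX$ there is a weak equivalence $\beta\colon U\widetilde{X}\to L_{\mathcal{C}}UX$ in $\mathcal{M}$ with $\beta\circ Ur = l$ in $\mathsf{Ho}(\mathcal{M})$. -/

import Mathlib

open CategoryTheory CategoryTheory.Limits HomotopicalAlgebra Simplicial Opposite

universe v u v' u'

namespace CoalgLoc

/-! ### Explicit model structures

Several model structures on the same category occur, so a model structure is an explicit term
`m : ModelCategory D`, and the following give access to its classes of maps and objects. -/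

section ModelStructures

variable {D : Type u} [Category.{v} D] (m : ModelCategory D)

/-- The weak equivalences of the model structure `m`. -/
def weq : MorphismProperty D := @weakEquivalences D _ m.categoryWithWeakEquivalences

/-- The cofibrations of the model structure `m`. -/
def cof : MorphismProperty D := @cofibrations D _ m.categoryWithCofibrations

/-- The fibrations of the model structure `m`. -/
def fib : MorphismProperty D := @fibrations D _ m.categoryWithFibrations

/-- The cofibrant objects of the model structure `m`. -/
def cofibrant : ObjectProperty D := fun X => letI := m; IsCofibrant X

/-- The fibrant objects of the model structure `m`. -/
def fibrant : ObjectProperty D := fun X => letI := m; IsFibrant X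

/-- Two objects are weakly equivalent if they are joined by a finite zigzag of
weak equivalences. -/
def WeaklyEquivalent (X Y : D) : Prop :=
  Relation.EqvGen (fun A B : D => ∃ f : A ⟶ B, weq m f) X Y

/-- The functor from `D` to the homotopy category `Ho(D)` of the model structure `m`,
i.e. the localization of `D` at the weak equivalences. -/
abbrev toHo : D ⥤ (weq m).Localization := (weq m).Q

end ModelStructures

/-! ### Homotopy function complexes -/

/-- Weak homotopy equivalences of simplicial sets: precomposition with `f` is a bijection
(surjective and injective) on simplicial homotopy classes of maps to every Kan complex. -/
def IsWeakEquivSSet {S T : SSet.{v}} (f : S ⟶ T) : Prop :=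
  ∀ (Z : SSet.{v}), SSet.KanComplex Z →
    (∀ g : S ⟶ Z, ∃ h : T ⟶ Z, Nonempty (SSet.Homotopy (f ≫ h) g)) ∧
    (∀ h h' : T ⟶ Z, Nonempty (SSet.Homotopy (f ≫ h) (f ≫ h')) →
      Nonempty (SSet.Homotopy h h'))

section FunctionComplexes

variable {D : Type u} [Category.{v} D]

/-- The latching category of `[n]`: injective, non-identity maps `[k] → [n]` in the simplex
category, and maps over `[n]` between them (these are automatically injective). -/
def latchingIndex (n : ℕ) : ObjectProperty (Over (SimplexCategory.mk n)) :=
  fun s => Mono s.hom ∧ ¬ IsIso s.hom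

/-- The latching diagram of a cosimplicial object at `[n]`; its colimit is the `n`-th
latching object. -/
def latchingDiagram (A : SimplexCategory ⥤ D) (n : ℕ) : (latchingIndex n).FullSubcategory ⥤ D :=
  (latchingIndex n).ι ⋙ Over.forget (SimplexCategory.mk n) ⋙ A

/-- The cocone on the latching diagram with point `A [n]`; the map from the colimit that it
induces is the `n`-th latching map. -/
def latchingCocone (A : SimplexCategory ⥤ D) (n : ℕ) : Cocone (latchingDiagram A n) where
  pt := A.obj (SimplexCategory.mk n)
  ι :=
    { app := fun s => A.map s.obj.hom
      naturality := fun s t g => by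
        have h : A.map g.hom.left ≫ A.map t.obj.hom = A.map s.obj.hom := by
          rw [← A.map_comp, Over.w]
        simpa [latchingDiagram] using h }

/-- A cosimplicial object is Reedy cofibrant if all its latching maps are cofibrations. -/
def IsReedyCofibrant (m : ModelCategory D) (A : SimplexCategory ⥤ D) : Prop :=
  ∀ n : ℕ, ∃ (c : Cocone (latchingDiagram A n)) (hc : IsColimit c),
    cof m (hc.desc (latchingCocone A n))

/-- A cosimplicial resolution of `A`: a Reedy cofibrant approximation of the constant
cosimplicial object at `A`. -/
structure CosimplicialResolution (m : ModelCategory D) (A : D) where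
  /-- the cosimplicial object -/
  obj : SimplexCategory ⥤ D
  /-- the approximation map to the constant cosimplicial object -/
  ε : obj ⟶ (Functor.const SimplexCategory).obj A
  reedyCofibrant : IsReedyCofibrant m obj
  weq_app : ∀ n : SimplexCategory, weq m (ε.app n)

/-- The simplicial set `n ↦ D(Aⁿ, X)`. -/
def mapSSet (A : SimplexCategory ⥤ D) (X : D) : SSet.{v} := A.op ⋙ yoneda.obj X

/-- The map `D(Bⁿ, X) → D(Aⁿ, X)` given by precomposition with `φ : A → B`. -/
def mapSSetPrecomp {A B : SimplexCategory ⥤ D} (φ : A ⟶ B) (X : D) :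
    mapSSet B X ⟶ mapSSet A X :=
  Functor.whiskerRight (NatTrans.op φ) (yoneda.obj X)

/-- For fibrant `X`, the map of homotopy function complexes `map(B, X) → map(A, X)` induced by
`f : A → B` is a weak equivalence of simplicial sets. The complexes and the map are computed by
a cosimplicial resolution of `f`; whether the map is a weak equivalence does not depend on
the resolution. -/
def MapIsWeq (m : ModelCategory D) {A B : D} (f : A ⟶ B) (X : D) : Prop :=
  ∃ (A' : CosimplicialResolution m A) (B' : CosimplicialResolution m B) (φ : A'.obj ⟶ B'.obj),
    φ ≫ B'.ε = A'.ε ≫ (Functor.const SimplexCategory).map f ∧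
    IsWeakEquivSSet (mapSSetPrecomp φ X)

/-! ### Left Bousfield localization -/

/-- The `𝒞`-local objects. -/
def IsLocalObject (m : ModelCategory D) (𝒞 : MorphismProperty D) : ObjectProperty D :=
  fun X => fibrant m X ∧ ∀ ⦃A B : D⦄ (f : A ⟶ B), 𝒞 f → MapIsWeq m f X

/-- The `𝒞`-local equivalences. -/
def localEquivalences (m : ModelCategory D) (𝒞 : MorphismProperty D) : MorphismProperty D :=
  fun _ _ f => ∀ X : D, IsLocalObject m 𝒞 X → MapIsWeq m f X

/-- `mL` is the left Bousfield localization of the model structure `m` at `𝒞`: the cofibrations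
are those of `m`, the weak equivalences are the `𝒞`-local equivalences (these two classes
determine the fibrations), and the fibrant objects are exactly the `𝒞`-local objects. -/
structure IsLeftBousfieldLocalization (m : ModelCategory D) (𝒞 : MorphismProperty D)
    (mL : ModelCategory D) : Prop where
  cof_eq : cof mL = cof m
  weq_eq : weq mL = localEquivalences m 𝒞
  fibrant_eq : fibrant mL = IsLocalObject m 𝒞

/-- A localization `L_𝒞 Y` of an object `Y`: a cofibrant approximation `q : Q → Y`
followed by a `𝒞`-local equivalence `j` from `Q` to a `𝒞`-local object. -/
structure LocalizationOf (m : ModelCategory D) (𝒞 : MorphismProperty D) (Y : D) where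
  /-- the cofibrant approximation -/
  Q : D
  /-- the approximation map -/
  q : Q ⟶ Y
  cofibrant_Q : cofibrant m Q
  weq_q : weq m q
  /-- the localized object -/
  obj : D
  /-- the localization map out of the cofibrant approximation -/
  j : Q ⟶ obj
  isLocalObject : IsLocalObject m 𝒞 obj
  localEquivalence_j : localEquivalences m 𝒞 j

/-- The localization map `l : Y → L_𝒞 Y` in the homotopy category. -/
noncomputable def LocalizationOf.l {m : ModelCategory D} {𝒞 : MorphismProperty D} {Y : D}
    (Λ : LocalizationOf m 𝒞 Y) : (toHo m).obj Y ⟶ (toHo m).obj Λ.obj :=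
  (Localization.isoOfHom (toHo m) (weq m) Λ.q Λ.weq_q).inv ≫ (toHo m).map Λ.j

end FunctionComplexes

/-! ### Left-induced model structures and preservation of coalgebras -/

/-- The model structure `mN` is left-induced from `mM` along the left adjoint `L`. -/
structure IsLeftInduced {N : Type u'} [Category.{v'} N] {M : Type u} [Category.{v} M]
    {L : N ⥤ M} {R : M ⥤ N} (_adj : L ⊣ R) (mM : ModelCategory M) (mN : ModelCategory N) :
    Prop where
  weq_iff : ∀ ⦃A B : N⦄ (f : A ⟶ B), weq mN f ↔ weq mM (L.map f)
  cof_iff : ∀ ⦃A B : N⦄ (f : A ⟶ B), cof mN f ↔ cof mM (L.map f)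

/-- The localization `L_𝒞` preserves `K`-coalgebras. Here `m` is the model structure on `M` and
`mK` the one on `K`-coalgebras. The naturality of the choice of `X → X'` for cofibrant `X`
means that it is a natural transformation from the inclusion of cofibrant coalgebras to
a functor `T`. -/
structure PreservesCoalgebras {M : Type u} [Category.{v} M] (m : ModelCategory M)
    (𝒞 : MorphismProperty M) (K : Comonad M) (mK : ModelCategory K.Coalgebra) : Prop where
  exists_coalgebra : ∀ X : K.Coalgebra, ∃ X' : K.Coalgebra,
    IsLocalObject m 𝒞 (K.forget.obj X') ∧
    ∀ Λ : LocalizationOf m 𝒞 (K.forget.obj X), WeaklyEquivalent m (K.forget.obj X') Λ.obj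
  exists_natural : ∃ (T : (cofibrant mK).FullSubcategory ⥤ K.Coalgebra)
    (r : (cofibrant mK).ι ⟶ T), ∀ X : (cofibrant mK).FullSubcategory,
      IsLocalObject m 𝒞 (K.forget.obj (T.obj X)) ∧
      ∀ Λ : LocalizationOf m 𝒞 (K.forget.obj X.obj),
        WeaklyEquivalent m (K.forget.obj (T.obj X)) Λ.obj ∧
        ∃ β : K.forget.obj (T.obj X) ⟶ Λ.obj, weq m β ∧
          (toHo m).map (K.forget.map (r.app X)) ≫ (toHo m).map β = Λ.l

end CoalgLoc

/-!
The statement uses the localization only through three facts about `mL`: it has the cofibrations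
of `m`, its weak equivalences are the local equivalences, and its fibrant objects are the local
objects, which are fibrant in `m`. A model structure is determined by its cofibrations and its
fibrant objects, and the argument for this gives all that is needed, so that homotopy function
complexes never have to be computed.

* Having the same cofibrations, `m` and `mL` have the same trivial fibrations, hence the same
  relative cylinder objects.
* Every weak equivalence of `m` is one of `mL` (`weq_le`). It suffices to treat a trivial
  cofibration `i` of `m`, and a pushout along an `mL`-fibrant replacement reduces to the case where
  the source is `mL`-fibrant (`weq_of_trivCof_of_fibrant`). The source is then `m`-fibrant and `i`
  has a retraction `r`. A homotopy relative to `i`, on a cylinder that serves both model structures,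
  shows that `r ≫ i` is a weak equivalence of `mL`, and `i` is a retract of `r ≫ i`.
* Conversely, a weak equivalence of `mL` between local objects is one of `m`
  (`weq_of_weq_of_fibrant`): by Ken Brown's factorization it is a section of a trivial fibration
  followed by a trivial fibration.

For a coalgebra `X`, let `X ⟶ X'` be a fibrant replacement in the model structure left-induced from
`mL`. By hypothesis `U X'` is `mL`-fibrant, that is, local, and `U X ⟶ U X'` is a trivial
cofibration of `mL`. Two `mL`-fibrant objects receiving `mL`-weak equivalences from the same object
are joined by a zigzag of `m`-weak equivalences (`weaklyEquivalent_of_span`), which gives the first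
part. If `U X` is moreover cofibrant, a localization `l : U X ⟶ L U X` is represented by a map of
`M` (`exists_represents`), and this map extends along the trivial cofibration `U X ⟶ U X'`.
-/

namespace CoalgLoc

/-! ### Basic properties of an explicit model structure -/

section ModelStructures

variable {D : Type u} [Category.{v} D] (m : ModelCategory D)

theorem weq_hasTwoOutOfThreeProperty : (weq m).HasTwoOutOfThreeProperty :=
  m.cm2

theorem weq_isStableUnderRetracts : (weq m).IsStableUnderRetracts :=
  m.cm3a

theorem weq_id (X : D) : weq m (𝟙 X) := by
  let := m
  exact (weakEquivalences D).id_mem X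

variable {m}

theorem weq_comp {X Y Z : D} {f : X ⟶ Y} {g : Y ⟶ Z} (hf : weq m f) (hg : weq m g) :
    weq m (f ≫ g) :=
  (weq_hasTwoOutOfThreeProperty m).comp_mem f g hf hg

theorem weq_of_precomp {X Y Z : D} {f : X ⟶ Y} {g : Y ⟶ Z} (hf : weq m f)
    (hfg : weq m (f ≫ g)) : weq m g :=
  (weq_hasTwoOutOfThreeProperty m).of_precomp f g hf hfg

theorem weq_of_postcomp {X Y Z : D} {f : X ⟶ Y} {g : Y ⟶ Z} (hg : weq m g)
    (hfg : weq m (f ≫ g)) : weq m f :=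
  (weq_hasTwoOutOfThreeProperty m).of_postcomp f g hg hfg

/-- A section of a weak equivalence is a weak equivalence. -/
theorem weq_of_comp_eq_id {X Y : D} {s : X ⟶ Y} {p : Y ⟶ X} (hp : weq m p)
    (h : s ≫ p = 𝟙 X) : weq m s :=
  weq_of_postcomp hp (h ▸ weq_id m X)

variable (m)

theorem exists_cof_trivFib {X Y : D} (f : X ⟶ Y) :
    ∃ (Z : D) (i : X ⟶ Z) (p : Z ⟶ Y), cof m i ∧ fib m p ∧ weq m p ∧ i ≫ p = f := by
  let := m
  let h := MorphismProperty.factorizationData (cofibrations D) (trivialFibrations D) f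
  exact ⟨h.Z, h.i, h.p, h.hi, h.hp.1, h.hp.2, h.fac⟩

theorem exists_trivCof_fib {X Y : D} (f : X ⟶ Y) :
    ∃ (Z : D) (i : X ⟶ Z) (p : Z ⟶ Y), cof m i ∧ weq m i ∧ fib m p ∧ i ≫ p = f := by
  let := m
  let h := MorphismProperty.factorizationData (trivialCofibrations D) (fibrations D) f
  exact ⟨h.Z, h.i, h.p, h.hi.1, h.hi.2, h.hp, h.fac⟩

theorem exists_fibrant_replacement (X : D) :
    ∃ (Z : D) (i : X ⟶ Z), cof m i ∧ weq m i ∧ fibrant m Z := by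
  let := m
  obtain ⟨Z, i, p, hi, hi', hp, -⟩ := exists_trivCof_fib m (terminal.from X)
  refine ⟨Z, i, hi, hi', ?_⟩
  have : Fibration p := ⟨hp⟩
  exact (isFibrant_iff_of_isTerminal p terminalIsTerminal).2 this

variable {m}

theorem hasLiftingProperty_of_trivCof {A B X Y : D} {i : A ⟶ B} {p : X ⟶ Y}
    (hi : cof m i) (hi' : weq m i) (hp : fib m p) : HasLiftingProperty i p := by
  let := m
  have : Cofibration i := ⟨hi⟩
  have : WeakEquivalence i := ⟨hi'⟩
  have : Fibration p := ⟨hp⟩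
  infer_instance

theorem trivFib_eq_rlp : fib m ⊓ weq m = (cof m).rlp := by
  let := m
  exact (MorphismProperty.rlp_eq_of_wfs (cofibrations D) (trivialFibrations D)).symm

/-- Maps to a fibrant object extend along trivial cofibrations. -/
theorem exists_extension {A B X : D} {i : A ⟶ B} (hi : cof m i) (hi' : weq m i)
    (hX : fibrant m X) (f : A ⟶ X) : ∃ g : B ⟶ X, i ≫ g = f := by
  let := m
  have hX' : IsFibrant X := hX
  have := hasLiftingProperty_of_trivCof hi hi' hX'.mem
  have sq : CommSq f i (terminal.from X) (terminal.from B) := ⟨Subsingleton.elim _ _⟩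
  exact ⟨sq.lift, sq.fac_left⟩

/-- A trivial fibration with cofibrant target has a section. -/
theorem exists_section {X Y : D} {p : X ⟶ Y} (hp : fib m p) (hp' : weq m p)
    (hY : cofibrant m Y) : ∃ s : Y ⟶ X, s ≫ p = 𝟙 Y := by
  let := m
  have hY' : IsCofibrant Y := hY
  have : Fibration p := ⟨hp⟩
  have : WeakEquivalence p := ⟨hp'⟩
  have sq : CommSq (initial.to X) (initial.to Y) p (𝟙 Y) := ⟨Subsingleton.elim _ _⟩
  exact ⟨sq.lift, sq.fac_right⟩

theorem fibrant_of_fib {X Y : D} {p : X ⟶ Y} (hp : fib m p) (hY : fibrant m Y) :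
    fibrant m X := by
  let := m
  have : IsFibrant Y := hY
  have : Fibration p := ⟨hp⟩
  exact isFibrant_of_fibration p

theorem trivCof_of_isPushout {A B A' P : D} {i : A ⟶ B} {a : A ⟶ A'} {b : B ⟶ P} {i' : A' ⟶ P}
    (sq : IsPushout a i i' b) (hi : cof m i) (hi' : weq m i) : cof m i' ∧ weq m i' := by
  let := m
  exact MorphismProperty.of_isPushout (P := trivialCofibrations D) sq ⟨hi, hi'⟩

/-- A map between fibrant objects factors as a section of a trivial fibration followed by
a fibration, by Ken Brown's factorization lemma. -/
theorem exists_brown_factorization {X Y : D} (f : X ⟶ Y) (hX : fibrant m X) (hY : fibrant m Y) :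
    ∃ (Z : D) (s : X ⟶ Z) (t : Z ⟶ X) (p : Z ⟶ Y),
      s ≫ p = f ∧ s ≫ t = 𝟙 X ∧ fib m t ∧ weq m t ∧ fib m p := by
  let := m
  have : IsFibrant X := hX
  have : IsFibrant Y := hY
  obtain ⟨h⟩ : Nonempty (FibrantBrownFactorization f) := inferInstance
  have ht : weq m h.r := weq_of_precomp (f := h.i) h.hi.2 (by rw [h.i_r]; exact weq_id m X)
  exact ⟨h.Z, h.i, h.r, h.p, h.fac, h.i_r, mem_fibrations h.r, ht, h.hp⟩

theorem weq_toHo_map_isIso {X Y : D} {f : X ⟶ Y} (hf : weq m f) : IsIso ((toHo m).map f) :=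
  Localization.inverts (toHo m) (weq m) f hf

end ModelStructures

/-! ### Two model structures with the same cofibrations -/

section Comparison

variable {D : Type u} [Category.{v} D] {m mL : ModelCategory D}

theorem trivFib_eq_of_cof_eq (hc : cof mL = cof m) : fib mL ⊓ weq mL = fib m ⊓ weq m := by
  rw [trivFib_eq_rlp, trivFib_eq_rlp, hc]

/-- A trivial cofibration of `m` whose source is `mL`-fibrant is a weak equivalence of `mL`, because
its source is a deformation retract of its target, by a homotopy that `mL` also recognizes. -/
theorem weq_of_trivCof_of_fibrant (hc : cof mL = cof m)
    (hf : ∀ X, fibrant mL X → fibrant m X) {A B : D} {i : A ⟶ B}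
    (hi : cof m i) (hi' : weq m i) (hA : fibrant mL A) : weq mL i := by
  have := m.cm1b
  obtain ⟨r, hr⟩ := exists_extension hi hi' (hf A hA) (𝟙 A)
  obtain ⟨B', b, hb, hb', hB'⟩ := exists_fibrant_replacement mL B
  -- a cylinder object of `B` relative to `i`, for both model structures
  obtain ⟨C, k, p, hk, hp, hp', hkp⟩ :=
    exists_cof_trivFib m (pushout.desc (f := i) (g := i) (𝟙 B) (𝟙 B) rfl)
  have hpL : weq mL p := by
    have h : (fib m ⊓ weq m) p := ⟨hp, hp'⟩
    rw [← trivFib_eq_of_cof_eq hc] at h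
    exact h.2
  obtain ⟨hl, hl'⟩ := trivCof_of_isPushout (IsPushout.of_hasPushout i i) hi hi'
  have h₀ : (pushout.inl i i ≫ k) ≫ p = 𝟙 B := by
    rw [Category.assoc, hkp]
    exact pushout.inl_desc _ _ _
  have h₁ : (pushout.inr i i ≫ k) ≫ p = 𝟙 B := by
    rw [Category.assoc, hkp]
    exact pushout.inr_desc _ _ _
  have hk' : weq m k := weq_of_precomp hl' (weq_of_comp_eq_id hp' h₀)
  -- the homotopy from `r ≫ i` to the identity relative to `i`, composed with `b` so that its
  -- target is `m`-fibrant
  obtain ⟨h, hh⟩ := exists_extension hk hk' (hf B' hB')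
    (pushout.desc (f := i) (g := i) (r ≫ i ≫ b) b (by rw [reassoc_of% hr]))
  have e₀ : (pushout.inl i i ≫ k) ≫ h = (r ≫ i) ≫ b := by
    rw [Category.assoc, hh, Category.assoc]
    exact pushout.inl_desc _ _ _
  have e₁ : (pushout.inr i i ≫ k) ≫ h = b := by
    rw [Category.assoc, hh]
    exact pushout.inr_desc _ _ _
  have hhL : weq mL h := weq_of_precomp (weq_of_comp_eq_id hpL h₁) (by rwa [e₁])
  have hri : weq mL (r ≫ i) :=
    weq_of_postcomp hb' (by rw [← e₀]; exact weq_comp (weq_of_comp_eq_id hpL h₀) hhL)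
  have ret : RetractArrow i (r ≫ i) :=
    { i := Arrow.homMk i (𝟙 B) (by simp [reassoc_of% hr])
      r := Arrow.homMk r (𝟙 B) (by simp)
      retract := by ext <;> simp [hr] }
  exact (weq_isStableUnderRetracts mL).of_retract ret hri

/-- Shrinking the class of fibrant objects while keeping the cofibrations can only enlarge the class
of weak equivalences. -/
theorem weq_le (hc : cof mL = cof m) (hf : ∀ X, fibrant mL X → fibrant m X) :
    weq m ≤ weq mL := by
  have := m.cm1b
  intro A B f hfm
  obtain ⟨Z, i, p, hi, hp, hp', rfl⟩ := exists_cof_trivFib m f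
  have hpL : (fib mL ⊓ weq mL) p := by
    rw [trivFib_eq_of_cof_eq hc]
    exact ⟨hp, hp'⟩
  refine weq_comp ?_ hpL.2
  have hi' : weq m i := weq_of_postcomp hp' hfm
  -- push out along `a`, so that the source of the trivial cofibration becomes `mL`-fibrant
  obtain ⟨A', a, ha, ha', hA'⟩ := exists_fibrant_replacement mL A
  obtain ⟨hj, hj'⟩ := trivCof_of_isPushout (IsPushout.of_hasPushout a i) hi hi'
  obtain ⟨-, hb⟩ := trivCof_of_isPushout (IsPushout.of_hasPushout a i).flip ha ha'
  refine weq_of_postcomp hb ?_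
  rw [← pushout.condition]
  exact weq_comp ha' (weq_of_trivCof_of_fibrant hc hf hj hj' hA')

/-- The converse of `weq_le` for maps between `mL`-fibrant objects: Ken Brown's factorization in `mL`
involves only trivial fibrations and their sections, and both model structures have the same
trivial fibrations. -/
theorem weq_of_weq_of_fibrant (hc : cof mL = cof m) {X Y : D} {f : X ⟶ Y}
    (hX : fibrant mL X) (hY : fibrant mL Y) (h : weq mL f) : weq m f := by
  obtain ⟨Z, s, t, p, rfl, hst, ht, ht', hp⟩ := exists_brown_factorization f hX hY
  have htm : (fib m ⊓ weq m) t := by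
    rw [← trivFib_eq_of_cof_eq hc]
    exact ⟨ht, ht'⟩
  have hpm : (fib m ⊓ weq m) p := by
    rw [← trivFib_eq_of_cof_eq hc]
    exact ⟨hp, weq_of_precomp (weq_of_comp_eq_id ht' hst) h⟩
  exact weq_comp (weq_of_comp_eq_id htm.2 hst) hpm.2

/-- Two `mL`-fibrant replacements of the same object are weakly equivalent in `m`; the maps
from the object need not be cofibrations. -/
theorem weaklyEquivalent_of_span (hc : cof mL = cof m) {Q X Y : D} {f : Q ⟶ X} {g : Q ⟶ Y}
    (hfL : weq mL f) (hgL : weq mL g) (hX : fibrant mL X) (hY : fibrant mL Y) : WeaklyEquivalent m X Y := by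
  obtain ⟨W, i, p, hi, hi', hp, rfl⟩ := exists_trivCof_fib mL g
  obtain ⟨f', rfl⟩ := exists_extension hi hi' hX f
  have hW : fibrant mL W := fibrant_of_fib hp hY
  exact .trans _ W _
    (.symm _ _ (.rel _ _ ⟨f', weq_of_weq_of_fibrant hc hW hX (weq_of_precomp hi' hfL)⟩))
    (.rel _ _ ⟨p, weq_of_weq_of_fibrant hc hW hY (weq_of_precomp hi' hgL)⟩)

end Comparison

/-! ### Maps in the homotopy category -/

section Represent

variable {D : Type u} [Category.{v} D] {m : ModelCategory D}

/-- A fraction `q⁻¹ ≫ j` in the homotopy category, from a cofibrant to a fibrant object, is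
represented by a map. The form `s ≫ j'` of this map, with `s` a weak equivalence and `j'` an
extension of `j` along a weak equivalence, makes it a weak equivalence in every localization of `m`
in which `j` is one. -/
theorem exists_represents {Q Y Z : D} {q : Q ⟶ Y} (hq : weq m q) (j : Q ⟶ Z)
    (hY : cofibrant m Y) (hZ : fibrant m Z) :
    ∃ (W : D) (s : Y ⟶ W) (i : Q ⟶ W) (j' : W ⟶ Z), weq m s ∧ weq m i ∧ i ≫ j' = j ∧
      (toHo m).map q ≫ (toHo m).map (s ≫ j') = (toHo m).map j := by
  obtain ⟨W, i, p, hi, hi', hp, rfl⟩ := exists_trivCof_fib m q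
  have hp' : weq m p := weq_of_precomp hi' hq
  obtain ⟨s, hs⟩ := exists_section hp hp' hY
  obtain ⟨j', rfl⟩ := exists_extension hi hi' hZ j
  refine ⟨W, s, i, j', weq_of_comp_eq_id hp' hs, hi', rfl, ?_⟩
  have := weq_toHo_map_isIso hp'
  have hps : (toHo m).map p ≫ (toHo m).map s = 𝟙 _ := by
    rw [← cancel_mono ((toHo m).map p), Category.assoc, ← Functor.map_comp, hs]
    simp
  simp only [Functor.map_comp, Category.assoc, reassoc_of% hps]

theorem LocalizationOf.map_q_comp_l {𝒞 : MorphismProperty D} {Y : D}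
    (Λ : LocalizationOf m 𝒞 Y) : (toHo m).map Λ.q ≫ Λ.l = (toHo m).map Λ.j := by
  have := weq_toHo_map_isIso Λ.weq_q
  simp [LocalizationOf.l]

end Represent

/-! ### Left Bousfield localizations and left-induced model structures -/

section Bousfield

variable {D : Type u} [Category.{v} D] {m mL : ModelCategory D} {𝒞 : MorphismProperty D}

theorem IsLeftBousfieldLocalization.fibrant_of_fibrant
    (hL : IsLeftBousfieldLocalization m 𝒞 mL) (X : D) (hX : fibrant mL X) : fibrant m X := by
  rw [hL.fibrant_eq] at hX
  exact hX.1

theorem LocalizationOf.fibrant_obj (hL : IsLeftBousfieldLocalization m 𝒞 mL) {Y : D}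
    (Λ : LocalizationOf m 𝒞 Y) : fibrant mL Λ.obj := by
  rw [hL.fibrant_eq]
  exact Λ.isLocalObject

theorem LocalizationOf.weq_j (hL : IsLeftBousfieldLocalization m 𝒞 mL) {Y : D}
    (Λ : LocalizationOf m 𝒞 Y) : weq mL Λ.j := by
  rw [hL.weq_eq]
  exact Λ.localEquivalence_j

/-- Every `mL`-fibrant object with an `mL`-weak equivalence from `Y` is weakly equivalent to every
localization of `Y`. -/
theorem LocalizationOf.weaklyEquivalent (hL : IsLeftBousfieldLocalization m 𝒞 mL) {Y Z : D}
    {f : Y ⟶ Z} (hf : weq mL f) (hZ : fibrant mL Z) (Λ : LocalizationOf m 𝒞 Y) :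
    WeaklyEquivalent m Z Λ.obj :=
  weaklyEquivalent_of_span hL.cof_eq
    (weq_comp (weq_le hL.cof_eq hL.fibrant_of_fibrant _ Λ.weq_q) hf) (Λ.weq_j hL) hZ
    (Λ.fibrant_obj hL)

/-- For cofibrant `Y`, every localization map of `Y` factors in the homotopy category through
a given `mL`-fibrant replacement of `Y`, by a weak equivalence. -/
theorem LocalizationOf.exists_comparison (hL : IsLeftBousfieldLocalization m 𝒞 mL) {Y Z : D}
    {f : Y ⟶ Z} (hf : cof mL f) (hf' : weq mL f) (hY : cofibrant m Y) (hZ : fibrant mL Z)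
    (Λ : LocalizationOf m 𝒞 Y) :
    ∃ β : Z ⟶ Λ.obj, weq m β ∧ (toHo m).map f ≫ (toHo m).map β = Λ.l := by
  have hle := weq_le hL.cof_eq hL.fibrant_of_fibrant
  obtain ⟨W, s, i, j', hs, hi, hij, hk⟩ :=
    exists_represents Λ.weq_q Λ.j hY Λ.isLocalObject.1
  obtain ⟨β, hβ⟩ := exists_extension hf hf' (Λ.fibrant_obj hL) (s ≫ j')
  have hj' : weq mL j' := weq_of_precomp (hle _ hi) (by rw [hij]; exact Λ.weq_j hL)
  have hβL : weq mL β :=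
    weq_of_precomp hf' (by rw [hβ]; exact weq_comp (hle _ hs) hj')
  refine ⟨β, weq_of_weq_of_fibrant hL.cof_eq hZ (Λ.fibrant_obj hL) hβL, ?_⟩
  have := weq_toHo_map_isIso Λ.weq_q
  rw [← cancel_epi ((toHo m).map Λ.q), Λ.map_q_comp_l, ← hk, ← hβ, Functor.map_comp]

end Bousfield

theorem IsLeftInduced.cofibrant_obj {N : Type u'} [Category.{v'} N] {M : Type u}
    [Category.{v} M] {L : N ⥤ M} {R : M ⥤ N} {adj : L ⊣ R} {mM : ModelCategory M}
    {mN : ModelCategory N} (h : IsLeftInduced adj mM mN) {X : N} (hX : cofibrant mN X) :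
    cofibrant mM (L.obj X) := by
  let := mM
  let := mN
  have := adj.leftAdjoint_preservesColimits
  have hX' : IsCofibrant X := hX
  have : Cofibration (L.map (initial.to X)) := ⟨(h.cof_iff _).1 hX'.mem⟩
  exact (isCofibrant_iff_of_isInitial (L.map (initial.to X))
    (IsInitial.isInitialObj L _ initialIsInitial)).2 this

/-- Functorial factorizations, applied to the maps to the terminal object, give a functorial
fibrant replacement. -/
theorem exists_functorial_fibrant_replacement {N : Type u} [Category.{v} N]
    (m : ModelCategory N)
    (hfact : MorphismProperty.HasFunctorialFactorization (cof m ⊓ weq m) (fib m)) :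
    ∃ (T : N ⥤ N) (r : 𝟭 N ⟶ T), ∀ X, cof m (r.app X) ∧ weq m (r.app X) ∧ fibrant m (T.obj X) := by
  let := m
  obtain ⟨⟨h⟩⟩ := hfact
  let F : N ⥤ Arrow N :=
    { obj X := Arrow.mk (terminal.from X)
      map f := Arrow.homMk f (𝟙 (⊤_ N)) (terminal.hom_ext _ _) }
  refine ⟨F ⋙ h.Z, Functor.whiskerLeft F h.i, fun X => ?_⟩
  refine ⟨(h.hi (F.obj X)).1, (h.hi (F.obj X)).2, ?_⟩
  have : Fibration (h.p.app (F.obj X)) := ⟨h.hp (F.obj X)⟩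
  exact (isFibrant_iff_of_isTerminal (h.p.app (F.obj X)) terminalIsTerminal).2 this

end CoalgLoc

theorem mainTheorem4 {M : Type u} [Category.{v} M]
    -- the model category `M`, a class of cofibrations between cofibrant objects, and `L_𝒞 M`
    (m : ModelCategory M) (𝒞 : MorphismProperty M)
    (h𝒞 : ∀ ⦃A B : M⦄ (f : A ⟶ B), 𝒞 f →
      CoalgLoc.cof m f ∧ CoalgLoc.cofibrant m A ∧ CoalgLoc.cofibrant m B)
    (mL : ModelCategory M) (hL : CoalgLoc.IsLeftBousfieldLocalization m 𝒞 mL)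
    -- the comonad, with the left-induced model structure on coalgebras over `M`
    (K : Comonad M)
    (mK : ModelCategory K.Coalgebra) (hK : CoalgLoc.IsLeftInduced K.adj m mK)
    -- the left-induced model structure on coalgebras over `L_𝒞 M`; as for any model category
    -- in the paper's sense, fibrant replacement may be chosen functorially
    (mLK : ModelCategory K.Coalgebra) (hLK : CoalgLoc.IsLeftInduced K.adj mL mLK)
    (hfact : MorphismProperty.HasFunctorialFactorization
      (CoalgLoc.cof mLK ⊓ CoalgLoc.weq mLK) (CoalgLoc.fib mLK))
    -- the forgetful functor to `L_𝒞 M` preserves fibrant objects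
    (hfib : ∀ X : K.Coalgebra, CoalgLoc.fibrant mLK X → CoalgLoc.fibrant mL (K.forget.obj X)) :
    CoalgLoc.PreservesCoalgebras m 𝒞 K mK := by
  obtain ⟨T, r, hT⟩ := CoalgLoc.exists_functorial_fibrant_replacement mLK hfact
  have hloc (X : K.Coalgebra) : CoalgLoc.IsLocalObject m 𝒞 (K.forget.obj (T.obj X)) := by
    rw [← hL.fibrant_eq]
    exact hfib _ (hT X).2.2
  have hcof (X : K.Coalgebra) : CoalgLoc.cof mL (K.forget.map (r.app X)) :=
    (hLK.cof_iff _).1 (hT X).1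
  have hweq (X : K.Coalgebra) : CoalgLoc.weq mL (K.forget.map (r.app X)) :=
    (hLK.weq_iff _).1 (hT X).2.1
  refine ⟨fun X => ⟨T.obj X, hloc X, fun Λ => Λ.weaklyEquivalent hL (hweq X) (hfib _ (hT X).2.2)⟩,
    (CoalgLoc.cofibrant mK).ι ⋙ T, Functor.whiskerLeft (CoalgLoc.cofibrant mK).ι r,
    fun X => ⟨hloc X.obj, fun Λ => ⟨?_, ?_⟩⟩⟩
  · exact Λ.weaklyEquivalent hL (hweq X.obj) (hfib _ (hT X.obj).2.2)
  · exact Λ.exists_comparison hL (hcof X.obj) (hweq X.obj) (hK.cofibrant_obj X.property)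
      (hfib _ (hT X.obj).2.2)
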